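/- Let $M$ be a finite-dimensional $C^1$ manifold without boundary, endowed with a continuous Riemannian metric, and let $d$ be the associated Riemannian distance (with $d(x,y)=+\infty$ if $x$ and $y$ lie in different connected components). Let $f:M\to M$ be a $C^1$-diffeomorphism and let $K\subset M$ be a compact set with $f(K)=K$. Assume that $f|_K$ is uniquely ergodic, i.e. that there is exactly one $f$-invariant Borel probability measure $\mu$ on $M$ with $\mu(M\setminus K)=0$, and that all the Lyapunov exponents of $\mu$ are zero, i.e. that for $\mu$-almost every $x$ and every nonzero $v\in T_xM$, $$\lim_{n\to+\infty}\frac1n\log\|D_xf^n v\|=0\quad\text{and}\quad\lim_{n\to-\infty}\frac1n\log\|D_xf^n v\|=0 .$$ Let $W^s(K,f)=\{x\in M:\ \lim_{n\to+\infty}d(f^n(x),K)=0\}$ and let $x_0\in W^s(K,f)\setminus K$. Then $$\forall\,\varepsilon>0,\qquad \lim_{n\to+\infty}e^{\varepsilon n}\,d(f^n(x_0),K)=+\infty .$$ -/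

import Mathlib

open Set Filter Topology MeasureTheory Manifold Bundle
open scoped ENNReal

/-- `ν` is a Borel probability measure carried by `K` and invariant under `f`. -/
structure IsInvariantProbabilityOn {M : Type*} [MeasurableSpace M] (f : M → M) (K : Set M)
    (ν : Measure M) : Prop where
  isProbabilityMeasure : IsProbabilityMeasure ν
  measurePreserving : MeasurePreserving f ν ν
  measure_compl : ν Kᶜ = 0

/-- The restriction of `f` to `K` is uniquely ergodic: there is exactly one invariant Borel
probability measure carried by `K`. -/
def IsUniquelyErgodicOn {M : Type*} [MeasurableSpace M] (f : M → M) (K : Set M) : Prop :=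
  ∃! ν : Measure M, IsInvariantProbabilityOn f K ν

/-- The stable set `W^s(K, f)`: the points whose forward orbit converges to `K`. -/
def stableSet {M : Type*} [PseudoEMetricSpace M] (f : M → M) (K : Set M) : Set M :=
  {x | Tendsto (fun n : ℕ => Metric.infEDist (f^[n] x) K) atTop (𝓝 0)}

/-- The tangent vector `v` at `x` has (two-sided) Lyapunov exponent `c` for the `C^1`
diffeomorphism `f`: `(1/n) log ‖D_x f^n v‖ → c` as `n → +∞` and as `n → -∞`. -/
structure HasLyapunovExponent {E : Type*} [NormedAddCommGroup E] [NormedSpace ℝ E]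
    {H : Type*} [TopologicalSpace H] {I : ModelWithCorners ℝ E H}
    {M : Type*} [TopologicalSpace M] [ChartedSpace H M]
    [RiemannianBundle (fun x : M => TangentSpace I x)]
    (f : Diffeomorph I I M M 1) (x : M) (v : TangentSpace I x) (c : ℝ) : Prop where
  forward : Tendsto
    (fun n : ℕ => (1 / (n : ℝ)) * Real.log ‖mfderiv I I ((f : M → M)^[n]) x v‖) atTop (𝓝 c)
  backward : Tendsto
    (fun n : ℕ => (1 / (-(n : ℝ))) * Real.log ‖mfderiv I I ((f.symm : M → M)^[n]) x v‖)
    atTop (𝓝 c)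

/-- All Lyapunov exponents of the measure `μ` are zero: at `μ`-almost every point every nonzero
tangent vector has Lyapunov exponent zero, that is, the Oseledets splitting at that point is
reduced to one space, with exponent zero. -/
def AllLyapunovExponentsZero {E : Type*} [NormedAddCommGroup E] [NormedSpace ℝ E]
    {H : Type*} [TopologicalSpace H] {I : ModelWithCorners ℝ E H}
    {M : Type*} [TopologicalSpace M] [ChartedSpace H M] [MeasurableSpace M]
    [RiemannianBundle (fun x : M => TangentSpace I x)]
    (f : Diffeomorph I I M M 1) (μ : Measure M) : Prop :=
  ∀ᵐ x ∂μ, ∀ v : TangentSpace I x, v ≠ 0 → HasLyapunovExponent f x v 0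

/-!
A point whose orbit approached `K` at an exponential rate would, read backwards, be an orbit
leaving `K` at an exponential rate, whereas `f⁻¹` expands only subexponentially along `K`.

The expansion of the iterates of `f⁻¹` is measured by the functions
`aₙ x = log⁺ ‖D_x f⁻ⁿ‖` on `K`, which are continuous (`continuous_norm_mfderiv`) and form a
subadditive cocycle. The hypothesis on the exponents makes `aₙ / n` tend to `0` almost everywhere,
and `aₙ / n` is bounded, so `∫ aₘ / m` is small for some `m`. By unique ergodicity the Birkhoff
averages of the continuous function `aₘ` are then small *uniformly* on `K`
(`eventually_forall_birkhoffAverage_lt`: a weak limit of empirical measures is invariant), and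
subadditivity bounds `aₙ` by the Birkhoff sums of `aₘ / m`
(`mul_le_birkhoffSum_of_subadditive`). Hence `‖D_x f⁻ᴺ‖ ≤ e^{εN}` on all of `K` for large `N`
(`eventually_forall_norm_mfderiv_symm_iterate_le`).

By continuity a slightly weaker bound holds near `K`. Integrating it along almost minimizing paths
gives `d (f⁻ᴺ y) K ≤ e^{εN} d y K` for `y` near `K` (`exists_infEDist_map_le_mul`). Along the orbit
of `x₀` this reads `d (fⁿ x₀) K ≤ e^{εN} d (fⁿ⁺ᴺ x₀) K`, and these distances are positive because
`x₀ ∉ K`; so they decay no faster than `e^{-εn}`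
(`tendsto_exp_mul_top_of_le_exp_mul_shift`).
-/

open scoped BoundedContinuousFunction

/-! ### Continuity of the norm of the derivative -/

theorem continuous_norm_comp_comp {F F' G G' : Type*}
    [NormedAddCommGroup F] [NormedSpace ℝ F] [NormedAddCommGroup F'] [NormedSpace ℝ F']
    [NormedAddCommGroup G] [NormedSpace ℝ G] [NormedAddCommGroup G'] [NormedSpace ℝ G']
    (S : F' →L[ℝ] G') (R : G →L[ℝ] F) :
    Continuous fun T : F →L[ℝ] F' => ‖S ∘L T ∘L R‖ := by
  fun_prop

/-- If `u` and `b` agree asymptotically up to every factor `r ^ 2 > 1`, they have the same limit. -/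
theorem tendsto_of_forall_eventually_le_mul {α : Type*} {l : Filter α} {u b : α → ℝ} {c : ℝ}
    (hb : Tendsto b l (𝓝 c)) (h₁ : ∀ r : ℝ, 1 < r → ∀ᶠ y in l, u y ≤ r * (b y * r))
    (h₂ : ∀ r : ℝ, 1 < r → ∀ᶠ y in l, b y ≤ r * (u y * r)) : Tendsto u l (𝓝 c) := by
  refine tendsto_order.2 ⟨fun a ha => ?_, fun a ha => ?_⟩
  · have ht : Tendsto (fun r : ℝ => r * (a * r)) (𝓝[>] 1) (𝓝 (1 * (a * 1))) :=
      ((by fun_prop : Continuous fun r : ℝ => r * (a * r)).tendsto 1).mono_left nhdsWithin_le_nhds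
    obtain ⟨r, hr, hr1⟩ := ((ht.eventually_lt_const (u := c) (by simpa using ha)).and
      self_mem_nhdsWithin).exists
    have hr0 : (0 : ℝ) < r := zero_lt_one.trans hr1
    filter_upwards [hb.eventually_const_lt hr, h₂ r hr1] with y hy hy'
    have := hy.trans_le hy'
    exact lt_of_mul_lt_mul_right (lt_of_mul_lt_mul_left this hr0.le) hr0.le
  · have ht : Tendsto (fun r : ℝ => r * (c * r)) (𝓝[>] 1) (𝓝 (1 * (c * 1))) :=
      ((by fun_prop : Continuous fun r : ℝ => r * (c * r)).tendsto 1).mono_left nhdsWithin_le_nhds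
    obtain ⟨r, hr, hr1⟩ := ((ht.eventually_lt_const (u := a) (by simpa using ha)).and
      self_mem_nhdsWithin).exists
    have hr0 : (0 : ℝ) < r := zero_lt_one.trans hr1
    filter_upwards [(((hb.mul_const r).const_mul r).eventually_lt_const hr), h₁ r hr1] with y hy hy'
    exact hy'.trans_lt hy

theorem norm_comp_comp_le_of_lt {F F' G G' : Type*}
    [NormedAddCommGroup F] [NormedSpace ℝ F] [NormedAddCommGroup F'] [NormedSpace ℝ F']
    [NormedAddCommGroup G] [NormedSpace ℝ G] [NormedAddCommGroup G'] [NormedSpace ℝ G']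
    {S : F' →L[ℝ] G'} {T : F →L[ℝ] F'} {R : G →L[ℝ] F} {r : ℝ} (hS : ‖S‖ < r) (hR : ‖R‖ < r) :
    ‖S ∘L T ∘L R‖ ≤ r * (‖T‖ * r) := by
  have hr : 0 ≤ r := (norm_nonneg _).trans hS.le
  grw [ContinuousLinearMap.opNorm_comp_le, ContinuousLinearMap.opNorm_comp_le, hS, hR]

section
variable {E : Type*} [NormedAddCommGroup E] [NormedSpace ℝ E]
  {H : Type*} [TopologicalSpace H] {I : ModelWithCorners ℝ E H}
  {M : Type*} [TopologicalSpace M] [ChartedSpace H M] [IsManifold I 1 M]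
  [RiemannianBundle (fun x : M => TangentSpace I x)]
  [IsContinuousRiemannianBundle E (fun x : M => TangentSpace I x)]

/-- The operator norm of the derivative of a `C^1` map, for a continuous Riemannian metric, is
continuous. Near `x` the coordinate changes between the tangent spaces at `x` and at `y` distort
norms by factors close to `1`, and the derivative read in the tangent spaces at `x` and `h x` is
continuous. -/
theorem continuous_norm_mfderiv {h : M → M} (hh : ContMDiff I I 1 h) :
    Continuous fun x => ‖mfderiv I I h x‖ := by
  rw [continuous_iff_continuousAt]
  intro x
  let e := trivializationAt E (fun x : M => TangentSpace I x) x
  let e' := trivializationAt E (fun x : M => TangentSpace I x) (h x)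
  have hx : x ∈ e.baseSet := FiberBundle.mem_baseSet_trivializationAt' x
  have hx' : h x ∈ e'.baseSet := FiberBundle.mem_baseSet_trivializationAt' (h x)
  have h2 := ((hh.contMDiffAt (x := x)).mfderiv_const (m := 0) (by simp)).continuousAt
  let S := e'.symmL ℝ (h x)
  let R := e.continuousLinearMapAt ℝ x
  -- `B y` is the derivative at `y`, transported to a map between the tangent spaces at `x` and `h x`
  let B : M → (TangentSpace I x →L[ℝ] TangentSpace I (h x)) := fun y =>
    S ∘L (inTangentCoordinates I I id h (mfderiv I I h) x y) ∘L R
  have hB : ContinuousAt (fun y => ‖B y‖) x :=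
    (continuous_norm_comp_comp S R).continuousAt.comp h2
  have hBv (y : M) (v : TangentSpace I x) : B y v =
      e'.symmL ℝ (h x) (e'.continuousLinearMapAt ℝ (h y)
        (mfderiv I I h y (e.symmL ℝ y (e.continuousLinearMapAt ℝ x v)))) := rfl
  -- the derivative at `y` and its transport differ by factors that are nearly isometric
  have key : ∀ y ∈ e.baseSet, h y ∈ e'.baseSet → mfderiv I I h y =
      (e'.symmL ℝ (h y) ∘L e'.continuousLinearMapAt ℝ (h x)) ∘L B y ∘L
        (e.symmL ℝ x ∘L e.continuousLinearMapAt ℝ y) := by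
    intro y hy hy'
    ext v
    simp only [ContinuousLinearMap.comp_apply, hBv, e.continuousLinearMapAt_symmL hx,
      e'.continuousLinearMapAt_symmL hx', e.symmL_continuousLinearMapAt hy,
      e'.symmL_continuousLinearMapAt hy']
  have key' : ∀ y, B y = (e'.symmL ℝ (h x) ∘L e'.continuousLinearMapAt ℝ (h y)) ∘L
      mfderiv I I h y ∘L (e.symmL ℝ y ∘L e.continuousLinearMapAt ℝ x) := fun y => rfl
  have hBx : ‖B x‖ = ‖mfderiv I I h x‖ := by
    congr 1
    ext v
    rw [hBv, e.symmL_continuousLinearMapAt hx, e'.symmL_continuousLinearMapAt hx']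
  have hc : Tendsto h (𝓝 x) (𝓝 (h x)) := hh.continuous.continuousAt
  refine tendsto_of_forall_eventually_le_mul (b := fun y => ‖B y‖)
    (by beta_reduce; rw [← hBx]; exact hB) (fun r hr => ?_) (fun r hr => ?_)
  · filter_upwards [e.open_baseSet.mem_nhds hx, hc (e'.open_baseSet.mem_nhds hx'),
      eventually_norm_symmL_trivializationAt_self_comp_lt E (fun x : M => TangentSpace I x) x hr,
      hc.eventually (eventually_norm_symmL_trivializationAt_comp_self_lt E
        (fun x : M => TangentSpace I x) (h x) hr)] with y hy hy' h₁ h₂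
    rw [key y hy hy']
    exact norm_comp_comp_le_of_lt h₂ h₁
  · filter_upwards [
      eventually_norm_symmL_trivializationAt_comp_self_lt E (fun x : M => TangentSpace I x) x hr,
      hc.eventually (eventually_norm_symmL_trivializationAt_self_comp_lt E
        (fun x : M => TangentSpace I x) (h x) hr)] with y h₁ h₂
    rw [key' y]
    exact norm_comp_comp_le_of_lt h₂ h₁
end

/-! ### Distances to a compact invariant set -/

section
variable {E : Type*} [NormedAddCommGroup E] [NormedSpace ℝ E]
  {H : Type*} [TopologicalSpace H] {I : ModelWithCorners ℝ E H}
  {M : Type*} [EMetricSpace M] [ChartedSpace H M]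
  [RiemannianBundle (fun x : M => TangentSpace I x)]

theorem Manifold.pathELength_comp_le {h : M → M} (hh : MDifferentiable I I h)
    {γ : ℝ → M} {a b : ℝ}
    (hγ : MDifferentiableOn 𝓘(ℝ) I γ (Icc a b)) {C : ℝ}
    (hC : ∀ t ∈ Icc a b, ‖mfderiv I I h (γ t)‖ ≤ C) :
    pathELength I (h ∘ γ) a b ≤ ENNReal.ofReal C * pathELength I γ a b := by
  rw [pathELength_eq_lintegral_mfderiv_Ioo, pathELength_eq_lintegral_mfderiv_Ioo,
    ← lintegral_const_mul' _ _ ENNReal.ofReal_ne_top]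
  refine setLIntegral_mono' measurableSet_Ioo fun t ht => ?_
  have hγt : MDifferentiableAt 𝓘(ℝ) I γ t :=
    (hγ t (Ioo_subset_Icc_self ht)).mdifferentiableAt (Icc_mem_nhds ht.1 ht.2)
  rw [mfderiv_comp t (hh (γ t)) hγt]
  have := ((mfderiv I I h (γ t)).le_opNorm (mfderiv 𝓘(ℝ) I γ t 1)).trans
    (mul_le_mul_of_nonneg_right (hC t (Ioo_subset_Icc_self ht)) (norm_nonneg _))
  have hC0 : 0 ≤ C := (ContinuousLinearMap.opNorm_nonneg _).trans (hC t (Ioo_subset_Icc_self ht))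
  rw [← ofReal_norm, ← ofReal_norm, ← ENNReal.ofReal_mul hC0]
  exact ENNReal.ofReal_le_ofReal this

variable [IsRiemannianManifold I M]

/-- The mean value inequality on a ball. It is stated with the center as one of the two points: a
path from `z` that is shorter than `r` stays in the ball of radius `r` around `z`. -/
theorem edist_map_le_mul_of_norm_mfderiv_le {h : M → M} (hh : ContMDiff I I 1 h)
    {z y : M} {r : ℝ≥0∞} (hzy : edist z y < r) {C : ℝ}
    (hC : ∀ p ∈ Metric.eball z r, ‖mfderiv I I h p‖ ≤ C) :
    edist (h z) (h y) ≤ ENNReal.ofReal C * edist z y := by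
  have key : ∀ s, edist z y < s → s ≤ r → edist (h z) (h y) ≤ ENNReal.ofReal C * s := by
    intro s hs hsr
    rw [IsRiemannianManifold.out (I := I)] at hs
    obtain ⟨γ, h0, h1, hγ, hlen⟩ := exists_lt_of_riemannianEDist_lt hs
    rw [IsRiemannianManifold.out (I := I)]
    calc riemannianEDist I (h z) (h y) ≤ pathELength I (h ∘ γ) 0 1 :=
          riemannianEDist_le_pathELength (hh.comp_contMDiffOn hγ) (by simp [h0]) (by simp [h1])
            zero_le_one
      _ ≤ ENNReal.ofReal C * pathELength I γ 0 1 := by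
          refine pathELength_comp_le (hh.mdifferentiable one_ne_zero)
            (hγ.mdifferentiableOn one_ne_zero) fun t ht => hC _ ?_
          rw [Metric.mem_eball, edist_comm, IsRiemannianManifold.out (I := I)]
          calc riemannianEDist I z (γ t) ≤ pathELength I γ 0 t :=
                riemannianEDist_le_pathELength (hγ.mono (Icc_subset_Icc_right ht.2)) h0 rfl ht.1
            _ ≤ pathELength I γ 0 1 := pathELength_mono le_rfl ht.2
            _ < r := hlen.trans_le hsr
      _ ≤ ENNReal.ofReal C * s := by gcongr
  have ht : Tendsto (fun s => ENNReal.ofReal C * s) (𝓝[>] (edist z y))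
      (𝓝 (ENNReal.ofReal C * edist z y)) :=
    (ENNReal.continuous_const_mul ENNReal.ofReal_ne_top).continuousAt.mono_left nhdsWithin_le_nhds
  have : (𝓝[>] (edist z y)).NeBot := nhdsGT_neBot_of_exists_gt ⟨r, hzy⟩
  refine ge_of_tendsto ht ?_
  filter_upwards [Ioc_mem_nhdsGT hzy] with s hs using key s hs.1 hs.2

/-- The bound on the derivative is assumed on `K` only; by continuity it persists on a neighborhood
of `K`, which contains the short paths from a point near `K` to a nearest point of `K`. -/
theorem exists_infEDist_map_le_mul [IsManifold I 1 M]
  [IsContinuousRiemannianBundle E (fun x : M => TangentSpace I x)]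
    {h : M → M} (hh : ContMDiff I I 1 h) {K : Set M} (hK : IsCompact K) (hhK : MapsTo h K K)
    {C : ℝ} (hC : ∀ p ∈ K, ‖mfderiv I I h p‖ < C) :
    ∃ δ : ℝ≥0∞, 0 < δ ∧ ∀ y, Metric.infEDist y K < δ →
      Metric.infEDist (h y) K ≤ ENNReal.ofReal C * Metric.infEDist y K := by
  obtain ⟨δ, hδ, hU⟩ := hK.exists_thickening_subset_open
    (isOpen_lt (continuous_norm_mfderiv hh) (continuous_const (y := C))) hC
  refine ⟨ENNReal.ofReal δ, by simpa using hδ, fun y hy => ?_⟩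
  have hne : K.Nonempty := by
    rw [nonempty_iff_ne_empty]
    rintro rfl
    simp at hy
  obtain ⟨z, hz, hzy⟩ := hK.exists_infEDist_eq_edist hne y
  rw [hzy, edist_comm y z]
  calc Metric.infEDist (h y) K ≤ edist (h y) (h z) := Metric.infEDist_le_edist_of_mem (hhK hz)
    _ = edist (h z) (h y) := edist_comm _ _
    _ ≤ ENNReal.ofReal C * edist z y := by
      refine edist_map_le_mul_of_norm_mfderiv_le hh (r := ENNReal.ofReal δ)
        (by rwa [edist_comm, ← hzy]) fun p hp => ?_
      exact (hU ((Metric.infEDist_le_edist_of_mem hz).trans_lt hp)).le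
end

/-! ### Uniform upper bounds for Birkhoff averages -/

section
variable {X : Type*} [MeasurableSpace X]

/-- The uniform probability measure on the orbit segment `x, T x, …, T^[n] x`. The length is
`n + 1`, so that it is a probability measure for every `n`. -/
noncomputable def empiricalMeasure (T : X → X) (n : ℕ) (x : X) : ProbabilityMeasure X :=
  ⟨((n + 1 : ℕ) : ℝ≥0∞)⁻¹ • ∑ i ∈ Finset.range (n + 1), Measure.dirac (T^[i] x), ⟨by
    simp only [Measure.smul_apply, Measure.coe_finsetSum, Finset.sum_apply, measure_univ,
      Finset.sum_const, Finset.card_range, smul_eq_mul, nsmul_eq_mul, mul_one]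
    exact ENNReal.inv_mul_cancel (by simp) (by simp)⟩⟩

theorem integral_empiricalMeasure [TopologicalSpace X] [OpensMeasurableSpace X] (T : X → X) (n : ℕ)
    (x : X) (φ : X →ᵇ ℝ) :
    ∫ y, φ y ∂(empiricalMeasure T n x : Measure X) = birkhoffAverage ℝ T φ (n + 1) x := by
  have hm : StronglyMeasurable φ := φ.continuous.stronglyMeasurable
  rw [empiricalMeasure, ProbabilityMeasure.coe_mk, integral_smul_measure,
    integral_finsetSum_measure fun i _ => (integrable_dirac' hm (by simp))]
  simp [birkhoffAverage, birkhoffSum, integral_dirac' _ _ hm, ENNReal.toReal_inv,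
    ENNReal.toReal_add]

/-- If a continuous function has integral less than `c` against every invariant probability
measure, then its Birkhoff averages are eventually less than `c`, uniformly in the point. Otherwise
a weak limit of empirical measures along bad orbit segments would be an invariant measure against
which the integral is at least `c`. -/
theorem eventually_forall_birkhoffAverage_lt [TopologicalSpace X] [T2Space X] [CompactSpace X]
    [BorelSpace X] [HasOuterApproxClosed X] {T : X → X} (hT : Continuous T) {φ : X → ℝ}
    (hφ : Continuous φ) {c : ℝ}
    (h : ∀ ν : Measure X, IsProbabilityMeasure ν → MeasurePreserving T ν ν → ∫ x, φ x ∂ν < c) :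
    ∀ᶠ n : ℕ in atTop, ∀ x, birkhoffAverage ℝ T φ n x < c := by
  suffices H : ∀ᶠ n : ℕ in atTop, ∀ x, birkhoffAverage ℝ T φ (n + 1) x < c by
    obtain ⟨N, hN⟩ := eventually_atTop.1 H
    refine eventually_atTop.2 ⟨N + 1, fun n hn x => ?_⟩
    obtain ⟨m, rfl⟩ := Nat.exists_eq_add_of_le' hn
    exact hN (m + N) (Nat.le_add_left _ _) x
  by_contra hne
  rw [not_eventually] at hne
  -- the pairs (length, starting point) of bad orbit segments
  let s : Set (ℕ × X) := {p | c ≤ birkhoffAverage ℝ T φ (p.1 + 1) p.2}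
  have : (comap Prod.fst atTop ⊓ 𝓟 s : Filter (ℕ × X)).NeBot := by
    rw [inf_principal_neBot_iff]
    rintro U ⟨V, hV, hVU⟩
    obtain ⟨n, hn, hnV⟩ := (hne.and_eventually hV).exists
    push Not at hn
    obtain ⟨x, hx⟩ := hn
    exact ⟨(n, x), hVU hnV, hx⟩
  -- an ultrafilter makes the empirical measures converge, with no need for a subsequence
  let 𝓤 := Ultrafilter.of (comap Prod.fst atTop ⊓ 𝓟 s : Filter (ℕ × X))
  have hU1 : Tendsto Prod.fst (𝓤 : Filter (ℕ × X)) atTop :=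
    tendsto_comap.mono_left ((Ultrafilter.of_le _).trans inf_le_left)
  have hU2 : ∀ᶠ p in (𝓤 : Filter (ℕ × X)), p ∈ s :=
    ((Ultrafilter.of_le _).trans inf_le_right) (mem_principal_self s)
  obtain ⟨ν, -, hν⟩ := isCompact_univ.ultrafilter_le_nhds
    (𝓤.map fun p => empiricalMeasure T p.1 p.2) (by simp)
  have hν' : Tendsto (fun p : ℕ × X => empiricalMeasure T p.1 p.2) 𝓤 (𝓝 ν) := hν
  rw [ProbabilityMeasure.tendsto_iff_forall_integral_tendsto] at hν'
  simp only [integral_empiricalMeasure] at hν'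
  have hinv : MeasurePreserving T (ν : Measure X) ν := by
    refine ⟨hT.measurable, ?_⟩
    have := Measure.isProbabilityMeasure_map (μ := (ν : Measure X)) hT.measurable.aemeasurable
    refine ext_of_forall_integral_eq_of_IsFiniteMeasure fun ψ => ?_
    rw [integral_map hT.measurable.aemeasurable ψ.continuous.stronglyMeasurable.aestronglyMeasurable]
    have h1 := hν' (ψ.compContinuous ⟨T, hT⟩)
    have h2 := hν' ψ
    -- the two Birkhoff sums differ by one boundary term at each end of the orbit segment
    have h3 : Tendsto (fun p : ℕ × X => birkhoffAverage ℝ T (ψ.compContinuous ⟨T, hT⟩) (p.1 + 1) p.2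
        - birkhoffAverage ℝ T ψ (p.1 + 1) p.2) 𝓤 (𝓝 0) := by
      have h4 : Tendsto (fun n : ℕ => (2 * ‖ψ‖) / ((n + 1 : ℕ) : ℝ)) atTop (𝓝 0) :=
        (tendsto_const_nhds.div_atTop tendsto_natCast_atTop_atTop).comp (tendsto_add_atTop_nat 1)
      refine squeeze_zero_norm (fun p => ?_) (h4.comp hU1)
      have h5 : birkhoffAverage ℝ T (ψ.compContinuous ⟨T, hT⟩) (p.1 + 1) p.2 =
          birkhoffAverage ℝ T ψ (p.1 + 1) (T p.2) :=
        congrArg _ (Finset.sum_congr rfl fun i _ => congrArg ψ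
          ((Function.iterate_succ_apply' T i p.2).symm.trans (Function.iterate_succ_apply T i p.2)))
      rw [h5, ← dist_eq_norm, dist_birkhoffAverage_apply_birkhoffAverage]
      exact div_le_div_of_nonneg_right (ψ.dist_le_two_norm _ _) (by positivity)
    have := tendsto_nhds_unique (h1.sub h2) h3
    exact sub_eq_zero.1 this
  have hlt := h ν inferInstance hinv
  have hge : c ≤ ∫ x, φ x ∂(ν : Measure X) :=
    ge_of_tendsto (hν' (BoundedContinuousFunction.mkOfCompact ⟨φ, hφ⟩)) hU2
  exact hlt.not_ge hge

/-! ### Subadditive cocycles over uniquely ergodic maps -/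

/-- A subadditive cocycle is bounded by the Birkhoff sums of `a m / m`, up to a constant. -/
theorem mul_le_birkhoffSum_of_subadditive {X : Type*} {T : X → X} {a : ℕ → X → ℝ}
    (hadd : ∀ m n x, a (m + n) x ≤ a m x + a n (T^[m] x))
    {m : ℕ} {D : ℝ} (hD : ∀ k ≤ m, ∀ x, a k x ≤ D) (n : ℕ) (x : X) :
    m * a (n + m) x ≤ birkhoffSum T (a m) n x + 2 * (m * D) := by
  -- summing `a (k + m) x - a k x ≤ a m (T^[k] x)` over `k` telescopes
  have h1 : ∀ k, ∑ i ∈ Finset.range m, a (k + i) x ≤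
      birkhoffSum T (a m) k x + ∑ i ∈ Finset.range m, a i x := by
    intro k
    induction k with
    | zero => simp
    | succ k ih =>
      have h2 : ∑ i ∈ Finset.range m, a (k + 1 + i) x + a k x =
          ∑ i ∈ Finset.range m, a (k + i) x + a (k + m) x := by
        rw [← Finset.sum_range_succ (fun i => a (k + i) x), Finset.sum_range_succ']
        simp [add_assoc, add_comm 1]
      rw [birkhoffSum_succ]
      linarith [hadd k m x]
  have h3 : ∑ i ∈ Finset.range m, a i x ≤ m * D := by
    simpa using Finset.sum_le_card_nsmul (Finset.range m) (fun i => a i x) D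
      fun i hi => hD i (Finset.mem_range.1 hi).le x
  -- each of the last `m` terms is at least `a (n + m) x - D`
  have h4 : m * (a (n + m) x - D) ≤ ∑ i ∈ Finset.range m, a (n + i) x := by
    simpa using Finset.card_nsmul_le_sum (Finset.range m) (fun i => a (n + i) x) (a (n + m) x - D)
      fun i hi => by
        have hi' := Finset.mem_range.1 hi
        have h5 := hadd (n + i) (m - i) x
        rw [show n + i + (m - i) = n + m by omega] at h5
        linarith [hD (m - i) (Nat.sub_le _ _) (T^[n + i] x)]
  linarith [h1 n]

section
variable [TopologicalSpace X] {T : X → X} {a : ℕ → X → ℝ}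

/-- A nonnegative continuous subadditive cocycle over a uniquely ergodic map that grows sublinearly
almost everywhere grows sublinearly uniformly. The hypothesis `hμ` says that `μ` is the only
possible invariant probability measure. -/
theorem eventually_forall_le_mul_of_subadditive [T2Space X] [CompactSpace X] [BorelSpace X]
    [HasOuterApproxClosed X] (hT : Continuous T) {μ : Measure X} [IsFiniteMeasure μ]
    (hμ : ∀ ν : Measure X, IsProbabilityMeasure ν → MeasurePreserving T ν ν → ν = μ)
    (ha : ∀ n, Continuous (a n)) (h0 : ∀ n x, 0 ≤ a n x) (hzero : ∀ x, a 0 x = 0)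
    (hadd : ∀ m n x, a (m + n) x ≤ a m x + a n (T^[m] x))
    (hlim : ∀ᵐ x ∂μ, Tendsto (fun n : ℕ => a n x / n) atTop (𝓝 0)) {ε : ℝ} (hε : 0 < ε) :
    ∀ᶠ n : ℕ in atTop, ∀ x, a n x ≤ ε * n := by
  obtain ⟨C, hC⟩ : ∃ C, ∀ x, a 1 x ≤ C := by
    obtain ⟨C, hC⟩ := (isCompact_range (ha 1)).bddAbove
    exact ⟨C, fun x => hC ⟨x, rfl⟩⟩
  rcases isEmpty_or_nonempty X with hX | ⟨⟨x₀⟩⟩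
  · exact Eventually.of_forall fun n x => hX.elim x
  have hC0 : 0 ≤ C := (h0 1 x₀).trans (hC x₀)
  have hlin : ∀ n x, a n x ≤ n * C := by
    intro n x
    induction n with
    | zero => simp [hzero]
    | succ n ih =>
      push_cast
      linarith [hadd n 1 x, hC (T^[n] x)]
  have hint : Tendsto (fun n : ℕ => ∫ x, a n x / n ∂μ) atTop (𝓝 0) := by
    have := tendsto_integral_of_dominated_convergence (μ := μ) (F := fun (n : ℕ) x => a n x / n)
      (f := fun _ => 0) (fun _ => C) (fun n => ((ha n).div_const _).aestronglyMeasurable)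
      (integrable_const C) (fun n => Eventually.of_forall fun x => ?_) hlim
    · simpa using this
    · rw [Real.norm_of_nonneg (div_nonneg (h0 n x) n.cast_nonneg)]
      exact div_le_of_le_mul₀ n.cast_nonneg hC0 (by linarith [hlin n x])
  obtain ⟨m, hm, hm0⟩ :=
    ((hint.eventually_lt_const (half_pos hε)).and (eventually_gt_atTop 0)).exists
  have hm0' : (0 : ℝ) < m := Nat.cast_pos.2 hm0
  have hav := eventually_forall_birkhoffAverage_lt hT (φ := a m) (ha m) (c := m * (ε / 2))
    fun ν hν hTν => by
      rw [hμ ν hν hTν]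
      rw [integral_div, div_lt_iff₀' hm0'] at hm
      exact hm
  -- this makes the constant `2 * m * (m * C)` of the subadditive bound negligible
  have hlarge : ∀ᶠ n : ℕ in atTop, 2 * (m * C) / (ε / 2) ≤ n :=
    tendsto_natCast_atTop_atTop.eventually_ge_atTop _
  obtain ⟨N, hN⟩ := eventually_atTop.1 ((hav.and hlarge).and (eventually_gt_atTop 0))
  refine eventually_atTop.2 ⟨N + m, fun n hn x => ?_⟩
  obtain ⟨k, rfl⟩ : ∃ k, n = k + m := ⟨n - m, by omega⟩
  obtain ⟨⟨h1, h2⟩, h3⟩ := hN k (by omega)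
  have h3' : (0 : ℝ) < k := Nat.cast_pos.2 h3
  have h4 := h1 x
  rw [birkhoffAverage, smul_eq_mul, inv_mul_lt_iff₀ h3'] at h4
  rw [div_le_iff₀ (half_pos hε)] at h2
  have h5 := mul_le_birkhoffSum_of_subadditive hadd (m := m) (D := m * C) (fun j hj x =>
    (hlin j x).trans (by gcongr)) k x
  have h6 : m * a (k + m) x ≤ m * (ε * (k + m)) := by
    have h7 := mul_le_mul_of_nonneg_left h2 hm0'.le
    have h8 : 0 ≤ m * (ε * m) := by positivity
    linarith
  push_cast
  exact le_of_mul_le_mul_left h6 hm0'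
end

end

/-! ### Growth of linear maps and of sequences -/

/-- If no vector is expanded exponentially, then neither is the operator norm, as it is controlled
by the images of a basis. -/
theorem tendsto_posLog_opNorm_div {V : Type*} [NormedAddCommGroup V] [NormedSpace ℝ V]
    [FiniteDimensional ℝ V] {W : ℕ → Type*} [∀ n, NormedAddCommGroup (W n)]
    [∀ n, NormedSpace ℝ (W n)] (A : ∀ n, V →L[ℝ] W n)
    (h : ∀ v, v ≠ 0 → Tendsto (fun n : ℕ => (1 / (n : ℝ)) * Real.log ‖A n v‖) atTop (𝓝 0)) :
    Tendsto (fun n : ℕ => Real.posLog ‖A n‖ / n) atTop (𝓝 0) := by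
  let b := Module.finBasis ℝ V
  let C : ℝ := Fintype.card (Fin (Module.finrank ℝ V)) • ‖b.equivFunL.toContinuousLinearMap‖
  refine tendsto_order.2 ⟨fun c hc => Eventually.of_forall fun n =>
    hc.trans_le (div_nonneg Real.posLog_nonneg n.cast_nonneg), fun ε hε => ?_⟩
  have h1 : ∀ᶠ n : ℕ in atTop, ∀ i, 1 / (n : ℝ) * Real.log ‖A n (b i)‖ < ε / 2 :=
    eventually_all.2 fun i => (h (b i) (b.ne_zero i)).eventually_lt_const (half_pos hε)
  have h2 : ∀ᶠ n : ℕ in atTop, Real.posLog C / n < ε / 2 :=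
    (tendsto_const_nhds.div_atTop tendsto_natCast_atTop_atTop).eventually_lt_const (half_pos hε)
  filter_upwards [h1, h2, eventually_gt_atTop 0] with n h1 h2 hn
  have hn' : (0 : ℝ) < n := Nat.cast_pos.2 hn
  have h3 : ‖A n‖ ≤ C * Real.exp (n * (ε / 2)) := by
    refine b.opNorm_le (Real.exp_nonneg _) fun i => (Real.le_exp_log _).trans ?_
    have := h1 i
    rw [one_div, inv_mul_lt_iff₀ hn'] at this
    exact Real.exp_le_exp.2 this.le
  have h4 : Real.posLog ‖A n‖ ≤ Real.posLog C + n * (ε / 2) := by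
    refine (Real.posLog_le_posLog (norm_nonneg _) h3).trans (Real.posLog_mul.trans ?_)
    rw [Real.posLog_apply (x := Real.exp _), Real.log_exp, max_eq_right (by positivity)]
  rw [div_lt_iff₀ hn'] at h2 ⊢
  nlinarith

/-- The sequence `exp (ε / 2 * n) * a n` does not decrease along steps of length `N`, so it is
bounded below by a positive constant; the other half of `ε` makes `exp (ε * n) * a n` tend to
infinity. -/
theorem tendsto_exp_mul_top_of_le_exp_mul_shift {a : ℕ → ℝ≥0∞} (ha : ∀ n, a n ≠ 0) {N : ℕ}
    (hN : 0 < N) {ε : ℝ} (hε : 0 < ε)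
    (h : ∀ᶠ n in atTop, a n ≤ ENNReal.ofReal (Real.exp (ε / 2 * N)) * a (n + N)) :
    Tendsto (fun n : ℕ => ENNReal.ofReal (Real.exp (ε * n)) * a n) atTop (𝓝 ⊤) := by
  obtain ⟨n₀, hn₀⟩ := eventually_atTop.1 h
  let b : ℕ → ℝ≥0∞ := fun n => ENNReal.ofReal (Real.exp (ε / 2 * n)) * a n
  have hb : ∀ n, n₀ ≤ n → b n ≤ b (n + N) := by
    intro n hn
    calc b n ≤ ENNReal.ofReal (Real.exp (ε / 2 * n)) *
          (ENNReal.ofReal (Real.exp (ε / 2 * N)) * a (n + N)) := by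
          exact mul_le_mul_right (hn₀ n hn) _
      _ = b (n + N) := by
          rw [← mul_assoc, ← ENNReal.ofReal_mul (Real.exp_nonneg _), ← Real.exp_add]
          simp only [b]
          push_cast
          ring_nf
  let c : ℝ≥0∞ := (Finset.Ico n₀ (n₀ + N)).inf b
  have hc : c ≠ 0 := by
    refine ((Finset.lt_inf_iff ENNReal.zero_lt_top).2 fun n _ => ?_).ne'
    exact ENNReal.mul_pos (by simpa using Real.exp_pos _) (ha n)
  have hcb : ∀ n, n₀ ≤ n → c ≤ b n := by
    intro n
    induction n using Nat.strong_induction_on with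
    | _ n ih =>
      intro hn
      by_cases hlt : n < n₀ + N
      · exact Finset.inf_le (Finset.mem_Ico.2 ⟨hn, hlt⟩)
      · have := hb (n - N) (by omega)
        rw [Nat.sub_add_cancel (by omega)] at this
        exact (ih (n - N) (by omega) (by omega)).trans this
  have hexp : Tendsto (fun n : ℕ => ENNReal.ofReal (Real.exp (ε / 2 * n))) atTop (𝓝 ⊤) :=
    ENNReal.tendsto_ofReal_atTop.comp (Real.tendsto_exp_atTop.comp
      (tendsto_natCast_atTop_atTop.const_mul_atTop (half_pos hε)))
  have htop := ENNReal.Tendsto.mul_const (b := c) hexp (Or.inl ENNReal.top_ne_zero)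
  rw [ENNReal.top_mul hc] at htop
  refine tendsto_nhds_top_mono htop ?_
  filter_upwards [eventually_ge_atTop n₀] with n hn
  calc ENNReal.ofReal (Real.exp (ε / 2 * n)) * c
      ≤ ENNReal.ofReal (Real.exp (ε / 2 * n)) * b n := mul_le_mul_right (hcb n hn) _
    _ = ENNReal.ofReal (Real.exp (ε * n)) * a n := by
      rw [← mul_assoc, ← ENNReal.ofReal_mul (Real.exp_nonneg _), ← Real.exp_add]
      ring_nf

/-! ### The derivative cocycle of the inverse diffeomorphism -/

section
variable {E : Type*} [NormedAddCommGroup E] [NormedSpace ℝ E]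
  {H : Type*} [TopologicalSpace H] {I : ModelWithCorners ℝ E H}
  {M : Type*} [TopologicalSpace M] [ChartedSpace H M]

theorem ContMDiff.iterate_self {g : M → M} {k : WithTop ℕ∞} (hg : ContMDiff I I k g) (n : ℕ) :
    ContMDiff I I k g^[n] := by
  induction n with
  | zero => exact contMDiff_id
  | succ n ih => exact ih.comp hg

variable [RiemannianBundle (fun x : M => TangentSpace I x)]

theorem posLog_norm_mfderiv_iterate_add_le {g : M → M} (hg : ContMDiff I I 1 g) (m n : ℕ) (x : M) :
    Real.posLog ‖mfderiv I I g^[m + n] x‖ ≤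
      Real.posLog ‖mfderiv I I g^[m] x‖ + Real.posLog ‖mfderiv I I g^[n] (g^[m] x)‖ := by
  rw [add_comm m n, Function.iterate_add, mfderiv_comp x
    ((hg.iterate_self n).mdifferentiable one_ne_zero _)
    ((hg.iterate_self m).mdifferentiable one_ne_zero _), add_comm]
  exact (Real.posLog_le_posLog (ContinuousLinearMap.opNorm_nonneg _)
    (ContinuousLinearMap.opNorm_comp_le _ _)).trans Real.posLog_mul

theorem posLog_norm_mfderiv_iterate_zero (g : M → M) (x : M) :
    Real.posLog ‖mfderiv I I g^[0] x‖ = 0 := by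
  rw [Function.iterate_zero, mfderiv_id, Real.posLog_eq_zero_iff,
    abs_of_nonneg (ContinuousLinearMap.opNorm_nonneg _)]
  exact ContinuousLinearMap.norm_id_le

theorem HasLyapunovExponent.tendsto_posLog_norm_mfderiv_symm_iterate [FiniteDimensional ℝ E]
    {f : Diffeomorph I I M M 1} {x : M}
    (h : ∀ v : TangentSpace I x, v ≠ 0 → HasLyapunovExponent f x v 0) :
    Tendsto (fun n : ℕ => Real.posLog ‖mfderiv I I f.symm^[n] x‖ / n) atTop (𝓝 0) := by
  have : FiniteDimensional ℝ (TangentSpace I x) := inferInstanceAs (FiniteDimensional ℝ E)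
  refine tendsto_posLog_opNorm_div (fun n => mfderiv I I f.symm^[n] x) fun v hv => ?_
  have := (h v hv).backward.neg
  simpa [div_neg] using this
end

/-- Invariant measures of the restriction of `f⁻¹` to `K` are invariant measures of `f` carried
by `K`. -/
theorem IsInvariantProbabilityOn.map_subtype_val {M : Type*} [TopologicalSpace M]
    [MeasurableSpace M] [BorelSpace M] (f : M ≃ₜ M) {K : Set M} (hK : MeasurableSet K)
    (hfK : MapsTo f.symm K K) {ν : Measure K} [IsProbabilityMeasure ν]
    (hν : MeasurePreserving (hfK.restrict f.symm K K) ν ν) :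
    IsInvariantProbabilityOn f K (ν.map Subtype.val) where
  isProbabilityMeasure := Measure.isProbabilityMeasure_map measurable_subtype_coe.aemeasurable
  measurePreserving := by
    have h : MeasurePreserving f.symm.toMeasurableEquiv (ν.map Subtype.val) (ν.map Subtype.val) := by
      refine ⟨f.symm.measurable, ?_⟩
      rw [Measure.map_map f.symm.toMeasurableEquiv.measurable measurable_subtype_coe]
      nth_rw 2 [← hν.map_eq]
      rw [Measure.map_map measurable_subtype_coe hν.measurable]
      rfl
    exact h.symm
  measure_compl := by
    rw [Measure.map_apply measurable_subtype_coe hK.compl]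
    simp

/-- If `f` is uniquely ergodic on `K` with vanishing exponents, the iterates of `f⁻¹` expand tangent
vectors over `K` at most subexponentially, uniformly on `K`. -/
theorem eventually_forall_norm_mfderiv_symm_iterate_le
    {E : Type*} [NormedAddCommGroup E] [NormedSpace ℝ E] [FiniteDimensional ℝ E]
    {H : Type*} [TopologicalSpace H] {I : ModelWithCorners ℝ E H}
    {M : Type*} [EMetricSpace M] [ChartedSpace H M] [IsManifold I 1 M]
    [RiemannianBundle (fun x : M => TangentSpace I x)]
    [IsContinuousRiemannianBundle E (fun x : M => TangentSpace I x)]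
    [MeasurableSpace M] [BorelSpace M]
    {f : Diffeomorph I I M M 1} {K : Set M} (hK : IsCompact K) (hfK : MapsTo f.symm K K)
    (hue : IsUniquelyErgodicOn f K) {μ : Measure M} (hμ : IsInvariantProbabilityOn f K μ)
    (hlyap : AllLyapunovExponentsZero f μ) {ε : ℝ} (hε : 0 < ε) :
    ∀ᶠ n : ℕ in atTop, ∀ x ∈ K, ‖mfderiv I I f.symm^[n] x‖ ≤ Real.exp (ε * n) := by
  have hKm : MeasurableSet K := hK.measurableSet
  have : CompactSpace K := isCompact_iff_compactSpace.1 hK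
  have hemb : MeasurableEmbedding (Subtype.val : K → M) := MeasurableEmbedding.subtype_coe hKm
  have hsymm : ContMDiff I I 1 f.symm := f.symm.contMDiff
  have hiter : ∀ (n : ℕ) (x : K), ((hfK.restrict f.symm K K)^[n] x : M) = f.symm^[n] x := by
    intro n x
    rw [hfK.iterate_restrict]
    rfl
  have := hμ.isProbabilityMeasure
  have hfin : IsFiniteMeasure (μ.comap (Subtype.val : K → M)) := by
    refine ⟨?_⟩
    rw [hemb.comap_apply]
    exact measure_lt_top _ _
  have key := eventually_forall_le_mul_of_subadditive
    (T := hfK.restrict f.symm K K) (μ := μ.comap Subtype.val)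
    (a := fun n x => Real.posLog ‖mfderiv I I f.symm^[n] (x : M)‖)
    (f.symm.continuous.restrict hfK)
    (fun ν hν hT => by
      have h1 := IsInvariantProbabilityOn.map_subtype_val f.toHomeomorph hKm hfK hT
      rw [← hue.unique h1 hμ, hemb.comap_map])
    (fun n => Real.continuous_posLog.comp
      ((continuous_norm_mfderiv (hsymm.iterate_self n)).comp continuous_subtype_val))
    (fun n x => Real.posLog_nonneg)
    (fun x => posLog_norm_mfderiv_iterate_zero _ _)
    (fun m n x => by
      rw [hiter]
      exact posLog_norm_mfderiv_iterate_add_le hsymm m n x)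
    (by
      refine (hemb.ae_map_iff (p := fun x : M => Tendsto (fun n : ℕ =>
        Real.posLog ‖mfderiv I I f.symm^[n] x‖ / n) atTop (𝓝 0))).1 ?_
      rw [hemb.map_comap]
      refine ae_restrict_of_ae ?_
      filter_upwards [hlyap] with x hx
      exact HasLyapunovExponent.tendsto_posLog_norm_mfderiv_symm_iterate hx) hε
  filter_upwards [key] with n hn x hx
  refine (Real.le_exp_log _).trans (Real.exp_le_exp.2 ?_)
  exact (le_max_right _ _).trans (hn ⟨x, hx⟩)

/-! ### Subexponential approach to `K` -/

theorem mainTheorem4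
    {E : Type*} [NormedAddCommGroup E] [NormedSpace ℝ E] [FiniteDimensional ℝ E]
    {H : Type*} [TopologicalSpace H] {I : ModelWithCorners ℝ E H}
    {M : Type*} [EMetricSpace M] [ChartedSpace H M] [IsManifold I 1 M]
    [BoundarylessManifold I M]
    [RiemannianBundle (fun x : M => TangentSpace I x)]
    [IsContinuousRiemannianBundle E (fun x : M => TangentSpace I x)]
    [IsRiemannianManifold I M]
    [MeasurableSpace M] [BorelSpace M]
    (f : Diffeomorph I I M M 1)
    (K : Set M) (hK : IsCompact K) (hfK : f '' K = K)
    (hue : IsUniquelyErgodicOn f K)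
    (μ : Measure M) (hμ : IsInvariantProbabilityOn f K μ)
    (hlyap : AllLyapunovExponentsZero f μ)
    (x₀ : M) (hx₀ : x₀ ∈ stableSet f K \ K) (ε : ℝ) (hε : 0 < ε) :
    Tendsto
      (fun n : ℕ =>
        ENNReal.ofReal (Real.exp (ε * n)) * Metric.infEDist ((f : M → M)^[n] x₀) K)
      atTop (𝓝 ⊤) := by
  have hinv : ∀ y, f y ∈ K → y ∈ K := by
    intro y hy
    rw [← hfK] at hy
    obtain ⟨z, hz, hzy⟩ := hy
    exact f.injective hzy ▸ hz
  have hsymmK : MapsTo f.symm K K := fun y hy => hinv _ (by simpa using hy)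
  -- the rate `ε / 4` on `K` leaves room for the rate `ε / 2` on a neighborhood of `K`
  obtain ⟨N, hNbound, hN⟩ := ((eventually_forall_norm_mfderiv_symm_iterate_le hK hsymmK hue hμ hlyap
    (show 0 < ε / 4 by positivity)).and (eventually_gt_atTop 0)).exists
  have hN' : (0 : ℝ) < N := Nat.cast_pos.2 hN
  obtain ⟨δ, hδ, hback⟩ := exists_infEDist_map_le_mul (C := Real.exp (ε / 2 * N))
    (f.symm.contMDiff.iterate_self N) hK (hsymmK.iterate N) fun p hp =>
      (hNbound p hp).trans_lt (Real.exp_lt_exp.2 (by gcongr; norm_num))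
  refine tendsto_exp_mul_top_of_le_exp_mul_shift (fun n h0 => ?_) hN hε ?_
  · have hmem : ∀ n : ℕ, f^[n] x₀ ∈ K → x₀ ∈ K := by
      intro n
      induction n with
      | zero => exact id
      | succ n ih =>
        rw [Function.iterate_succ_apply']
        exact fun h => ih (hinv _ h)
    exact hx₀.2 (hmem n ((Metric.mem_iff_infEDist_zero_of_closed hK.isClosed).2 h0))
  · have hlim : Tendsto (fun n : ℕ => Metric.infEDist (f^[n + N] x₀) K) atTop (𝓝 0) :=
      (tendsto_add_atTop_iff_nat N).2 hx₀.1
    filter_upwards [hlim.eventually_lt_const hδ] with n hn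
    have h1 : f.symm^[N] (f^[n + N] x₀) = f^[n] x₀ := by
      rw [add_comm, Function.iterate_add_apply]
      exact Function.LeftInverse.iterate f.symm_apply_apply N _
    simpa only [h1] using hback _ hn
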